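/- **Setting.** Let $\mathcal X$ be a measurable space, $\mathcal Y$ a set of labels, $D\in\mathbb N$ and $\Psi:\mathcal X\times\mathcal Y\to\mathbb R^D$. For $w\in\mathbb R^D$ let $h_w$ denote any predictor with $h_w(x)\in\operatorname{argmax}_{y\in\mathcal Y}\langle w,\Psi(x,y)\rangle$ for all $x$. A class $\mathcal H_\Psi\subseteq\mathcal Y^{\mathcal X}$ is a $D$-dimensional linear class (with embedding $\Psi$) if each of its members is of the form $h_w$. On a sample $S=((x_1,y_1),\dots,(x_m,y_m))$ the Crammer–Singer hard multi-class SVM computes the vector $w$ of smallest Euclidean norm subject to $\langle w,\Psi(x_i,y_i)-\Psi(x_i,y)\rangle\ge 1$ for all $i\in[m]$ and all $y\ne y_i$, and predicts with $h_w$: at each $x$ at which the argmax for $w$ is non-empty it returns one of its elements (ties of the computed $w$ may be broken arbitrarily; where the program has no solution or the argmax is empty, its prediction is arbitrary). Data are drawn i.i.d. from a probability distribution $P$ on $\mathcal X$ and labelled by a target $h\in\mathcal H_\Psi$. It is assumed that there are no ties: for some $w$ with $h=h_w$, for $P$-almost every $x$ the set $\operatorname{argmax}_y\langle w,\Psi(x,y)\rangle$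 equals $\{h(x)\}$ and, in case $\mathcal Y$ is infinite, there is $\gamma>0$ (depending on $x$) with $\langle w,\Psi(x,h(x))\rangle\ge\langle w,\Psi(x,y)\rangle+\gamma$ for all $y\neq h(x)$. It is also assumed that the set-valued map $x\mapsto\{\Psi(x,h(x))-\Psi(x,y): y\ne h(x)\}$ is measurable up to $P$-null sets, i.e. for every open $U\subseteq\mathbb R^D$ the set of $x$ at which this set meets $U$ is $P$-null-measurable (this is automatic if $\mathcal Y$ is countable and all $\Psi(\cdot,y)$ are measurable). The sample complexity $m[\mathrm{SVM},\mathcal H_\Psi](\epsilon,\delta)$ is the least $n$ such that for all $k\ge n$ and all such $P$ and $h$, the hypothesis $g$ returned on $k$ examples satisfies $P(\{x: g(x)\ne h(x)\})\le\epsilon$ with probability at least $1-\delta$. **Theorem.** (1) There is an absolute constant $C$ such that for every $\mathcal X,\mathcal Y,D,\Psi$ and every $D$-dimensional linear class $\mathcal H_\Psi$, the SVM learns $\mathcal H_\Psi$, i.e. $m[\mathrm{SVM},\mathcal H_\Psi](\epsilon,\delta)$ is finite for all $\epsilon,\delta\in(0,1)$, and for all $\epsilon\in(0,\tfrac12]$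 and $\delta\in(0,1)$ $$m[\mathrm{SVM},\mathcal H_\Psi](\epsilon,\delta)\le C\cdot\frac{D\log(1/\epsilon)+\log(1/\delta)}{\epsilon}.$$ (2) Let $S=((x_i,y_i))_{i\in[m]}$ be a sample and $Z=\{\Psi(x_i,y_i)-\Psi(x_i,y): i\in[m],\,y\ne y_i\}$. If $w$ solves the SVM program for $S$ and $w'$ is a point of minimal norm of $\operatorname{conv}(Z)$, then $w=\frac{\|w\|}{\|w'\|}\,w'$ with $\|w\|/\|w'\|>0$. If $\mathcal Y$ is finite and some $v\in\mathbb R^D$ satisfies $\langle v,\Psi(x_i,y_i)\rangle>\langle v,\Psi(x_i,y)\rangle$ for all $i$ and all $y\neq y_i$, then the SVM program has exactly one solution, and $\operatorname{conv}(Z)$ has exactly one point of minimal norm unless $Z$ is empty. -/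

import Mathlib

open MeasureTheory
open scoped ENNReal

/-- The labels of `x` with the largest linear score `⟪w, Ψ(x, y)⟫`. -/
def argmaxLabels {X Y : Type*} {D : ℕ} (Ψ : X → Y → EuclideanSpace ℝ (Fin D))
    (w : EuclideanSpace ℝ (Fin D)) (x : X) : Set Y :=
  {y | ∀ y' : Y, inner ℝ w (Ψ x y') ≤ inner ℝ w (Ψ x y)}

/-- `h` is (a choice of) the predictor `h_w`. -/
def Represents {X Y : Type*} {D : ℕ} (Ψ : X → Y → EuclideanSpace ℝ (Fin D))
    (w : EuclideanSpace ℝ (Fin D)) (h : X → Y) : Prop :=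
  ∀ x, h x ∈ argmaxLabels Ψ w x

/-- `H` is a `D`-dimensional linear class with embedding `Ψ`. -/
def IsLinearClass {X Y : Type*} {D : ℕ} (Ψ : X → Y → EuclideanSpace ℝ (Fin D))
    (H : Set (X → Y)) : Prop :=
  ∀ h ∈ H, ∃ w, Represents Ψ w h

/-- The no-ties assumption on the data distribution `P` and the target `h`: some `w` with `h = h_w`
has `h x` as its only optimal label, for almost every `x`. If there are infinitely many labels, the
optimal score is moreover separated from the scores of all other labels (for finitely many labels
this is automatic). -/
def NoTies {X Y : Type*} [MeasurableSpace X] {D : ℕ} (Ψ : X → Y → EuclideanSpace ℝ (Fin D))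
    (P : Measure X) (h : X → Y) : Prop :=
  ∃ w, Represents Ψ w h ∧ (∀ᵐ x ∂P, argmaxLabels Ψ w x = {h x}) ∧
    (Infinite Y → ∀ᵐ x ∂P, ∃ γ : ℝ, 0 < γ ∧
      ∀ y, y ≠ h x → inner ℝ w (Ψ x y) + γ ≤ inner ℝ w (Ψ x (h x)))

/-- Measurability of the data: the set-valued map `x ↦ {Ψ(x, h x) - Ψ(x, y) | y ≠ h x}` is
measurable up to `P`-null sets, in the usual sense for set-valued maps. For countably many labels
it holds as soon as each `Ψ(·, y)` is measurable and there are almost surely no ties. -/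
def MeasurableDifferences {X Y : Type*} [MeasurableSpace X] {D : ℕ}
    (Ψ : X → Y → EuclideanSpace ℝ (Fin D)) (P : Measure X) (h : X → Y) : Prop :=
  ∀ U : Set (EuclideanSpace ℝ (Fin D)), IsOpen U →
    NullMeasurableSet {x | ∃ y, y ≠ h x ∧ Ψ x (h x) - Ψ x y ∈ U} P

/-- `w` is a point of smallest norm of `K`. -/
def IsMinNormPoint {D : ℕ} (K : Set (EuclideanSpace ℝ (Fin D)))
    (w : EuclideanSpace ℝ (Fin D)) : Prop :=
  w ∈ K ∧ ∀ u ∈ K, ‖w‖ ≤ ‖u‖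

/-- The set `Z = {Ψ(x_i, y_i) - Ψ(x_i, y) | i ∈ [m], y ≠ y_i}` of a sample. -/
def sampleDifferences {X Y : Type*} {D m : ℕ} (Ψ : X → Y → EuclideanSpace ℝ (Fin D))
    (S : Fin m → X × Y) : Set (EuclideanSpace ℝ (Fin D)) :=
  {z | ∃ i y, y ≠ (S i).2 ∧ z = Ψ (S i).1 (S i).2 - Ψ (S i).1 y}

/-- The constraint set of the hard multi-class SVM. -/
def svmFeasible {X Y : Type*} {D m : ℕ} (Ψ : X → Y → EuclideanSpace ℝ (Fin D))
    (S : Fin m → X × Y) : Set (EuclideanSpace ℝ (Fin D)) :=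
  {w | ∀ i y, y ≠ (S i).2 → 1 ≤ inner ℝ w (Ψ (S i).1 (S i).2 - Ψ (S i).1 y)}

/-- `w` solves the hard multi-class SVM program on the sample `S`. -/
def IsSVMSolution {X Y : Type*} {D m : ℕ} (Ψ : X → Y → EuclideanSpace ℝ (Fin D))
    (S : Fin m → X × Y) (w : EuclideanSpace ℝ (Fin D)) : Prop :=
  IsMinNormPoint (svmFeasible Ψ S) w

/-- The sample is realized (without ties) by some `w`. -/
def IsRealized {X Y : Type*} {D m : ℕ} (Ψ : X → Y → EuclideanSpace ℝ (Fin D))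
    (S : Fin m → X × Y) : Prop :=
  ∃ w : EuclideanSpace ℝ (Fin D), ∀ i y, y ≠ (S i).2 →
    inner ℝ w (Ψ (S i).1 y) < inner ℝ w (Ψ (S i).1 (S i).2)

/-- A learning algorithm: a finite labelled sample is mapped to a hypothesis. -/
abbrev Learner (X Y : Type*) := (m : ℕ) → (Fin m → X × Y) → X → Y

/-- `A` is the hard multi-class SVM: on every sample whose program has a solution `w`, it returns a
predictor `h_w`, that is one that picks an optimal label for `w` wherever there is one (ties of `w`
may be broken in any way). -/
def IsSVMLearner {X Y : Type*} {D : ℕ} (Ψ : X → Y → EuclideanSpace ℝ (Fin D))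
    (A : Learner X Y) : Prop :=
  ∀ (m : ℕ) (S : Fin m → X × Y) (w : EuclideanSpace ℝ (Fin D)), IsSVMSolution Ψ S w →
    ∀ x, (argmaxLabels Ψ w x).Nonempty → A m S x ∈ argmaxLabels Ψ w x

/-- The error of the hypothesis `g` with respect to the distribution `P` and the labelling `l`. -/
noncomputable def predictionError {X Y : Type*} [MeasurableSpace X] (P : Measure X) (l g : X → Y) :
    ℝ≥0∞ :=
  P {x | l x ≠ g x}

/-- `n` examples suffice for `A` to learn `H` with accuracy `ε` and confidence `1 - δ`: for
every sample size `k ≥ n`, every distribution `P` and every target `h ∈ H` without ties, the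
probability that the hypothesis returned on `k` i.i.d. examples labelled by `h` has error larger
than `ε` is at most `δ`. -/
def SufficientSampleSize {X Y : Type*} [MeasurableSpace X] {D : ℕ}
    (Ψ : X → Y → EuclideanSpace ℝ (Fin D)) (H : Set (X → Y)) (A : Learner X Y)
    (ε δ : ℝ) (n : ℕ) : Prop :=
  ∀ k, n ≤ k → ∀ P : Measure X, IsProbabilityMeasure P → ∀ h ∈ H,
    NoTies Ψ P h → MeasurableDifferences Ψ P h →
    Measure.pi (fun _ : Fin k => P)
      {x | ENNReal.ofReal ε < predictionError P h (A k fun i => (x i, h (x i)))}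
        ≤ ENNReal.ofReal δ

/-- `n` is the sample complexity of `A` for learning `H` at `(ε, δ)`. -/
def IsSampleComplexity {X Y : Type*} [MeasurableSpace X] {D : ℕ}
    (Ψ : X → Y → EuclideanSpace ℝ (Fin D)) (H : Set (X → Y)) (A : Learner X Y)
    (ε δ : ℝ) (n : ℕ) : Prop :=
  IsLeast {n | SufficientSampleSize Ψ H A ε δ n} n

/-! Learning is a compression argument. The SVM vector is the shortest point `w` of an intersection
of `k` convex margin sets in `ℝ^D`, one per example. If every `D` of them contained a common point
shorter than `w`, Helly's theorem for these sets and the open ball of radius `‖w‖` would give a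
feasible point shorter than `w`. So `D` examples already determine `w`
(`IsMinNormPoint.exists_card_eq`). For a fixed choice of `D` examples the other `k - D` are
independent of the vector computed from them. Hence all of them satisfy its margin constraints,
although these fail on mass above `ε`, with probability at most `(1 - ε) ^ (k - D)`. A union bound
over the choices finishes. Fubini needs this vector to depend measurably on the examples, which is
the purpose of the measurable selection.

The dual statement is the equality case of Cauchy–Schwarz: `⟪w, w'⟫ ≥ 1` because `w'` lies in the
hull, and `‖w‖ * ‖w'‖ ≤ 1` because `w' / ‖w'‖ ^ 2` is feasible. -/

/-! ### Points of smallest norm and Helly's theorem. -/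

/-- A nonempty closed convex set has a unique point of smallest norm. -/
theorem existsUnique_isMinNormPoint {D : ℕ} {K : Set (EuclideanSpace ℝ (Fin D))}
    (hne : K.Nonempty) (hcl : IsClosed K) (hcv : Convex ℝ K) : ∃! w, IsMinNormPoint K w := by
  obtain ⟨w, hw, hd⟩ := hcl.exists_infDist_eq_dist hne 0
  have hmin : IsMinNormPoint K w := by
    refine ⟨hw, fun u hu => ?_⟩
    have := Metric.infDist_le_dist_of_mem (x := 0) hu
    rw [hd] at this
    simpa using this
  refine ⟨w, hmin, fun v hv => ?_⟩
  have hvw : ‖v‖ = ‖w‖ := le_antisymm (hv.2 w hw) (hmin.2 v hv.1)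
  by_contra hne'
  have hmem : (1 / 2 : ℝ) • v + (1 / 2 : ℝ) • w ∈ K :=
    hcv hv.1 hw (by norm_num) (by norm_num) (by norm_num)
  have hlt := norm_combo_lt_of_ne hvw.le le_rfl hne' (a := 1 / 2) (b := 1 / 2)
    (by norm_num) (by norm_num) (by norm_num)
  exact absurd (hmin.2 _ hmem) (not_le.2 hlt)

/-- The variational inequality of a point of smallest norm. -/
theorem IsMinNormPoint.sq_norm_le_inner {D : ℕ} {K : Set (EuclideanSpace ℝ (Fin D))}
    {w u : EuclideanSpace ℝ (Fin D)} (hw : IsMinNormPoint K w) (hcv : Convex ℝ K) (hu : u ∈ K) :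
    ‖w‖ ^ 2 ≤ inner ℝ w u := by
  have hiInf : ‖(0 : EuclideanSpace ℝ (Fin D)) - w‖ = ⨅ v : K, ‖(0 : EuclideanSpace ℝ (Fin D)) - v‖ := by
    have : Nonempty K := ⟨⟨w, hw.1⟩⟩
    refine le_antisymm (le_ciInf fun v => ?_) (ciInf_le ⟨0, ?_⟩ (⟨w, hw.1⟩ : K))
    · simpa using hw.2 v v.2
    · rintro _ ⟨v, rfl⟩
      exact norm_nonneg _
  have h := (norm_eq_iInf_iff_real_inner_le_zero hcv hw.1).1 hiInf u hu
  rw [zero_sub, inner_neg_left, inner_sub_right, real_inner_self_eq_norm_sq] at h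
  linarith

/-- A point of smallest norm in an intersection of convex sets in `ℝ^D` is a point of smallest norm
in the intersection of `D` of them. -/
theorem IsMinNormPoint.exists_card_eq {D k : ℕ} (hDk : D ≤ k)
    {C : Fin k → Set (EuclideanSpace ℝ (Fin D))} (hcv : ∀ i, Convex ℝ (C i))
    {w : EuclideanSpace ℝ (Fin D)} (hw : IsMinNormPoint (⋂ i, C i) w) :
    ∃ T : Finset (Fin k), T.card = D ∧ IsMinNormPoint (⋂ i : {i // i ∈ T}, C i) w := by
  by_contra! hcon
  have hwC : ∀ i, w ∈ C i := fun i => Set.mem_iInter.1 hw.1 i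
  let F : Option (Fin k) → Set (EuclideanSpace ℝ (Fin D)) :=
    fun o => o.elim (Metric.ball 0 ‖w‖) C
  have key : (⋂ o ∈ (Finset.univ : Finset (Option (Fin k))), F o).Nonempty := by
    refine Convex.helly_theorem (𝕜 := ℝ) (by simpa using hDk) ?_ ?_
    · rintro (_ | i) -
      · exact convex_ball 0 _
      · exact hcv i
    · intro I _ hI
      rw [finrank_euclideanSpace_fin] at hI
      -- With the ball in the subfamily, `D` of the sets `C i` remain and `hcon` gives a shorter
      -- common point; without it, `w` itself is common.
      by_cases hn : none ∈ I
      · have hcard : I.eraseNone.card = D := by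
          rw [Finset.card_eraseNone_of_mem hn, hI]; rfl
        have h := hcon _ hcard
        have hwT : w ∈ ⋂ i : {i // i ∈ I.eraseNone}, C i := Set.mem_iInter.2 fun i => hwC i
        simp only [IsMinNormPoint, not_and, not_forall, not_le] at h
        obtain ⟨u, hu, hlt⟩ := h hwT
        refine ⟨u, Set.mem_iInter₂.2 ?_⟩
        rintro (_ | i) hi
        · simpa [F] using hlt
        · exact Set.mem_iInter.1 hu ⟨i, Finset.mem_eraseNone.2 hi⟩
      · refine ⟨w, Set.mem_iInter₂.2 ?_⟩
        rintro (_ | i) hi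
        · exact absurd hi hn
        · exact hwC i
  obtain ⟨u, hu⟩ := key
  have hu' : ∀ o, u ∈ F o := fun o => Set.mem_iInter₂.1 hu o (Finset.mem_univ o)
  have h1 : ‖u‖ < ‖w‖ := by simpa [F] using hu' none
  exact absurd (hw.2 u (Set.mem_iInter.2 fun i => hu' (some i))) (not_le.2 h1)

/-! ### Measurable selection of the point of smallest norm. -/

/-- The set of `ω` for which an intersection of closed sets, chosen measurably, meets a compact set
is measurable. -/
theorem measurableSet_inter_nonempty {Ω ι E : Type*} [MeasurableSpace Ω] [Countable ι]
    [TopologicalSpace E] {A : ι → Set Ω} (hA : ∀ n, MeasurableSet (A n))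
    {K : ι → Set E} (hK : ∀ n, IsClosed (K n)) {Q : Set E} (hQ : IsCompact Q) :
    MeasurableSet {ω | (Q ∩ {w | ∀ n, ω ∈ A n → w ∈ K n}).Nonempty} := by
  -- By compactness it suffices to test finite subfamilies, of which there are countably many.
  have heq : {ω | (Q ∩ {w | ∀ n, ω ∈ A n → w ∈ K n}).Nonempty} =
      ⋂ s : Finset ι, {ω | (∀ n ∈ s, ω ∈ A n) → (Q ∩ ⋂ n ∈ s, K n).Nonempty} := by
    ext ω
    simp only [Set.mem_ofPred_eq, Set.mem_iInter]
    constructor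
    · rintro ⟨w, hwQ, hw⟩ s hs
      exact ⟨w, hwQ, Set.mem_iInter₂.2 fun n hn => hw n (hs n hn)⟩
    · intro h
      classical
      obtain ⟨w, hwQ, hw⟩ := hQ.inter_iInter_nonempty (fun n : {n // ω ∈ A n} => K n)
        (fun n => hK n) (fun u => by
          obtain ⟨w, hwQ, hw⟩ := h (u.map (Function.Embedding.subtype _)) (by simp +contextual)
          refine ⟨w, hwQ, Set.mem_iInter₂.2 fun n hn => Set.mem_iInter₂.1 hw n ?_⟩
          simpa using ⟨n.2, hn⟩)
      exact ⟨w, hwQ, fun n hn => Set.mem_iInter.1 hw ⟨n, hn⟩⟩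
  rw [heq]
  refine MeasurableSet.iInter fun s => ?_
  have : {ω | (∀ n ∈ s, ω ∈ A n) → (Q ∩ ⋂ n ∈ s, K n).Nonempty} =
      (⋂ n ∈ s, A n)ᶜ ∪ {_ω | (Q ∩ ⋂ n ∈ s, K n).Nonempty} := by
    ext ω
    simp [imp_iff_not_or]
  rw [this]
  exact (s.measurableSet_biInter fun n _ => hA n).compl.union (MeasurableSet.const _)

/-- The point of smallest norm of a measurably varying closed convex set can be chosen
measurably. -/
theorem exists_measurable_isMinNormPoint {Ω ι : Type*} {D : ℕ} [MeasurableSpace Ω] [Countable ι]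
    {A : ι → Set Ω} (hA : ∀ n, MeasurableSet (A n))
    {K : ι → Set (EuclideanSpace ℝ (Fin D))} (hK : ∀ n, IsClosed (K n))
    (hcv : ∀ ω, Convex ℝ {w | ∀ n, ω ∈ A n → w ∈ K n}) :
    ∃ W : Ω → EuclideanSpace ℝ (Fin D), Measurable W ∧
      ∀ ω v, IsMinNormPoint {w | ∀ n, ω ∈ A n → w ∈ K n} v → W ω = v := by
  classical
  set C : Ω → Set (EuclideanSpace ℝ (Fin D)) := fun ω => {w | ∀ n, ω ∈ A n → w ∈ K n} with hC
  have hcl : ∀ ω, IsClosed (C ω) := fun ω => by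
    have : C ω = ⋂ n, ⋂ (_ : ω ∈ A n), K n := by ext; simp [hC]
    rw [this]
    exact isClosed_iInter fun n => isClosed_iInter fun _ => hK n
  have huniq : ∀ ω, (C ω).Nonempty → ∃! w, IsMinNormPoint (C ω) w :=
    fun ω hne => existsUnique_isMinNormPoint hne (hcl ω) (hcv ω)
  let W : Ω → EuclideanSpace ℝ (Fin D) := fun ω =>
    if h : (C ω).Nonempty then (huniq ω h).choose else 0
  have hWmin : ∀ ω, (C ω).Nonempty → IsMinNormPoint (C ω) (W ω) := fun ω h => by
    simp only [W, dif_pos h]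
    exact (huniq ω h).choose_spec.1
  have hW0 : ∀ ω, ¬ (C ω).Nonempty → W ω = 0 := fun ω h => by simp only [W, dif_neg h]
  refine ⟨W, measurable_of_isClosed fun Q hQ => ?_, fun ω v hv =>
    (huniq ω ⟨v, hv.1⟩).unique (hWmin ω ⟨v, hv.1⟩) hv⟩
  have hmeas : ∀ R : Set (EuclideanSpace ℝ (Fin D)), IsCompact R →
      MeasurableSet {ω | (R ∩ C ω).Nonempty} := fun R hR => measurableSet_inter_nonempty hA hK hR
  have hB : ∀ r : ℝ, IsCompact (Metric.closedBall (0 : EuclideanSpace ℝ (Fin D)) r) :=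
    fun r => isCompact_closedBall 0 r
  have hN : MeasurableSet {ω | (C ω).Nonempty} := by
    have : {ω | (C ω).Nonempty} = ⋃ r : ℕ, {ω | (Metric.closedBall 0 (r : ℝ) ∩ C ω).Nonempty} := by
      ext ω
      simp only [Set.mem_ofPred_eq, Set.mem_iUnion]
      constructor
      · rintro ⟨w, hw⟩
        obtain ⟨r, hr⟩ := exists_nat_ge ‖w‖
        exact ⟨r, w, by simpa using hr, hw⟩
      · rintro ⟨r, w, -, hw⟩
        exact ⟨w, hw⟩
    rw [this]
    exact MeasurableSet.iUnion fun r => hmeas _ (hB r)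
  -- For nonempty `C ω`, the shortest point lies in `Q` iff every closed ball of rational radius
  -- that meets `C ω` meets `Q ∩ C ω`. The last term accounts for the default value `0`.
  have hpre : W ⁻¹' Q = ({ω | (C ω).Nonempty} ∩ ⋂ r : ℚ,
        ({ω | (Metric.closedBall 0 (r : ℝ) ∩ C ω).Nonempty}ᶜ ∪
          {ω | ((Q ∩ Metric.closedBall 0 (r : ℝ)) ∩ C ω).Nonempty})) ∪
      ({ω | (C ω).Nonempty}ᶜ ∩ {_ω | (0 : EuclideanSpace ℝ (Fin D)) ∈ Q}) := by
    ext ω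
    by_cases hne : (C ω).Nonempty
    · have hm := hWmin ω hne
      simp only [Set.mem_preimage, Set.mem_union, Set.mem_inter_iff, Set.mem_ofPred_eq, hne,
        Set.mem_iInter, Set.mem_compl_iff, true_and, not_true_eq_false, false_and, or_false]
      constructor
      · intro hQω r
        rw [← imp_iff_not_or]
        rintro ⟨u, hu, huC⟩
        have hu' : ‖u‖ ≤ r := by simpa using hu
        exact ⟨W ω, ⟨hQω, by simpa using (hm.2 u huC).trans hu'⟩, hm.1⟩
      · intro h
        have hr : ∀ r : ℚ, ‖W ω‖ < r → ∃ u ∈ Q ∩ C ω, ‖u‖ ≤ r := fun r hr => by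
          obtain ⟨u, ⟨huQ, hur⟩, huC⟩ := (imp_iff_not_or.2 (h r))
            ⟨W ω, by simpa using hr.le, hm.1⟩
          exact ⟨u, ⟨huQ, huC⟩, by simpa using hur⟩
        obtain ⟨r₀, hr₀⟩ := exists_rat_gt ‖W ω‖
        obtain ⟨u₀, hu₀, -⟩ := hr r₀ hr₀
        obtain ⟨v, hv, hd⟩ := (hQ.inter (hcl ω)).exists_infDist_eq_dist ⟨u₀, hu₀⟩ 0
        have hvmin : ∀ u ∈ Q ∩ C ω, ‖v‖ ≤ ‖u‖ := fun u hu => by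
          have := Metric.infDist_le_dist_of_mem (x := 0) hu
          rw [hd] at this
          simpa using this
        have hvW : ‖v‖ ≤ ‖W ω‖ := by
          refine le_of_forall_lt_rat_imp_le fun r hlt => ?_
          obtain ⟨u, hu, hur⟩ := hr r hlt
          exact (hvmin u hu).trans hur
        have hvm : IsMinNormPoint (C ω) v := ⟨hv.2, fun u hu => hvW.trans (hm.2 u hu)⟩
        rw [(huniq ω hne).unique hm hvm]
        exact hv.1
    · simp [hW0 ω hne, hne]
  rw [hpre]
  refine (hN.inter (MeasurableSet.iInter fun r => ?_)).union (hN.compl.inter (MeasurableSet.const _))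
  exact (hmeas _ (hB r)).compl.union (hmeas _ ((hB r).inter_left hQ))

/-! ### Generalization from consistency with the unused examples. -/

/-- A predictor computed from the examples in `T`, whose region of failure is `{x | (s, x) ∈ M}`,
is unlikely to have large error but to be consistent with all the other examples. -/
theorem measure_pi_consistent_le {X : Type*} [MeasurableSpace X] (P : Measure X)
    [IsProbabilityMeasure P] {k : ℕ} (T : Finset (Fin k)) (ε : ℝ≥0∞)
    {M : Set (({i // i ∈ T} → X) × X)} (hM : MeasurableSet M) :
    Measure.pi (fun _ : Fin k => P)
      {x | ε < P {z | ((fun i : {i // i ∈ T} => x i), z) ∈ M} ∧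
        ∀ j, j ∉ T → ((fun i : {i // i ∈ T} => x i), x j) ∉ M} ≤ (1 - ε) ^ (k - T.card) := by
  classical
  let Q : Set (({i // i ∈ T} → X) × ({i // i ∉ T} → X)) :=
    {p | ε < P {z | (p.1, z) ∈ M} ∧ ∀ j, (p.1, p.2 j) ∉ M}
  have hQ : MeasurableSet Q := by
    refine MeasurableSet.inter (measurableSet_lt measurable_const
      ((measurable_measure_prodMk_left hM).comp measurable_fst)) ?_
    have : {p : ({i // i ∈ T} → X) × ({i // i ∉ T} → X) | ∀ j, (p.1, p.2 j) ∉ M} =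
        ⋂ j, (fun p : ({i // i ∈ T} → X) × ({i // i ∉ T} → X) => (p.1, p.2 j)) ⁻¹' Mᶜ := by
      ext; simp
    change MeasurableSet {p : ({i // i ∈ T} → X) × ({i // i ∉ T} → X) | ∀ j, (p.1, p.2 j) ∉ M}
    rw [this]
    exact MeasurableSet.iInter fun j => hM.compl.preimage
      (measurable_fst.prodMk ((measurable_pi_apply j).comp measurable_snd))
  have hmp := measurePreserving_piEquivPiSubtypeProd (fun _ : Fin k => P) (fun i => i ∈ T)
  have heq : {x : Fin k → X | ε < P {z | ((fun i : {i // i ∈ T} => x i), z) ∈ M} ∧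
        ∀ j, j ∉ T → ((fun i : {i // i ∈ T} => x i), x j) ∉ M} =
      MeasurableEquiv.piEquivPiSubtypeProd (fun _ : Fin k => X) (fun i => i ∈ T) ⁻¹' Q := by
    ext x
    simp only [Set.mem_ofPred_eq, Set.mem_preimage, Q, Subtype.forall]
    rfl
  rw [heq, hmp.measure_preimage hQ.nullMeasurableSet, Measure.prod_apply hQ]
  refine (lintegral_mono (g := fun _ => (1 - ε) ^ (k - T.card)) fun s => ?_).trans (by simp)
  -- With the examples in `T` frozen at `s`, the slice is a product of copies of one set of mass
  -- below `1 - ε`, or empty.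
  by_cases hs : ε < P {z | (s, z) ∈ M}
  · have hsub : Prod.mk s ⁻¹' Q = Set.univ.pi fun _ : {i // i ∉ T} => {z | (s, z) ∈ M}ᶜ := by
      ext t
      simp [Q, hs]
    rw [hsub, Measure.pi_pi, Finset.prod_const, Finset.card_univ,
      prob_compl_eq_one_sub (s := {z | (s, z) ∈ M}) (measurable_prodMk_left hM)]
    have hcard : Fintype.card {i // i ∉ T} = k - T.card := by
      rw [Fintype.card_subtype_compl, Fintype.card_fin, Fintype.card_coe]
    rw [hcard]
    exact pow_le_pow_left₀ zero_le (tsub_le_tsub_left hs.le 1) _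
  · have : Prod.mk s ⁻¹' Q = ∅ := by
      ext t
      simp [Q, hs]
    rw [this]
    simp

/-! ### Margin constraints: feasibility and measurable description. -/

/-- The vectors that satisfy the SVM constraints of the single example `(x, h x)`. -/
def marginSet {X Y : Type*} {D : ℕ} (Ψ : X → Y → EuclideanSpace ℝ (Fin D)) (h : X → Y) (x : X) :
    Set (EuclideanSpace ℝ (Fin D)) :=
  {w | ∀ y, y ≠ h x → 1 ≤ inner ℝ w (Ψ x (h x) - Ψ x y)}

theorem convex_marginSet {X Y : Type*} {D : ℕ} (Ψ : X → Y → EuclideanSpace ℝ (Fin D)) (h : X → Y)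
    (x : X) : Convex ℝ (marginSet Ψ h x) := by
  intro u hu v hv a b ha hb hab y hy
  have h1 := mul_le_mul_of_nonneg_left (hu y hy) ha
  have h2 := mul_le_mul_of_nonneg_left (hv y hy) hb
  rw [inner_add_left, real_inner_smul_left, real_inner_smul_left]
  linarith

theorem svmFeasible_eq_iInter_marginSet {X Y : Type*} {D k : ℕ}
    (Ψ : X → Y → EuclideanSpace ℝ (Fin D)) (h : X → Y) (x : Fin k → X) :
    svmFeasible Ψ (fun i => (x i, h (x i))) = ⋂ i, marginSet Ψ h (x i) := by
  ext w
  simp [svmFeasible, marginSet]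

theorem convex_svmFeasible {X Y : Type*} {D m : ℕ} (Ψ : X → Y → EuclideanSpace ℝ (Fin D))
    (S : Fin m → X × Y) : Convex ℝ (svmFeasible Ψ S) := by
  intro u hu v hv a b ha hb hab i y hy
  have h1 := mul_le_mul_of_nonneg_left (hu i y hy) ha
  have h2 := mul_le_mul_of_nonneg_left (hv i y hy) hb
  rw [inner_add_left, real_inner_smul_left, real_inner_smul_left]
  linarith

theorem isClosed_svmFeasible {X Y : Type*} {D m : ℕ} (Ψ : X → Y → EuclideanSpace ℝ (Fin D))
    (S : Fin m → X × Y) : IsClosed (svmFeasible Ψ S) := by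
  simp only [svmFeasible, Set.ofPred_forall]
  refine isClosed_iInter fun i => isClosed_iInter fun y => isClosed_iInter fun _ => ?_
  exact isClosed_le continuous_const (continuous_id.inner continuous_const)

/-- If every example can be separated with a margin by the same vector, the SVM program is
feasible. -/
theorem svmFeasible_nonempty {X Y : Type*} {D m : ℕ} {Ψ : X → Y → EuclideanSpace ℝ (Fin D)}
    {S : Fin m → X × Y} {w : EuclideanSpace ℝ (Fin D)}
    (hw : ∀ i, ∃ γ : ℝ, 0 < γ ∧ ∀ y, y ≠ (S i).2 →
      inner ℝ w (Ψ (S i).1 y) + γ ≤ inner ℝ w (Ψ (S i).1 (S i).2)) :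
    (svmFeasible Ψ S).Nonempty := by
  choose γ hγ hsep using hw
  have hsum : ∀ i, (γ i)⁻¹ ≤ ∑ j, (γ j)⁻¹ := fun i =>
    Finset.single_le_sum (f := fun j => (γ j)⁻¹) (fun j _ => (inv_pos.2 (hγ j)).le)
      (Finset.mem_univ i)
  -- The sum of inverse margins dominates each of them, so one scaling serves all examples, even
  -- when there are none.
  refine ⟨(∑ j, (γ j)⁻¹) • w, fun i y hy => ?_⟩
  have h1 := hsep i y hy
  rw [real_inner_smul_left, inner_sub_right]
  calc (1 : ℝ) = (γ i)⁻¹ * γ i := (inv_mul_cancel₀ (hγ i).ne').symm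
    _ ≤ (∑ j, (γ j)⁻¹) * (inner ℝ w (Ψ (S i).1 (S i).2) - inner ℝ w (Ψ (S i).1 y)) :=
      mul_le_mul (hsum i) (by linarith) (hγ i).le ((inv_pos.2 (hγ i)).le.trans (hsum i))

/-- Finitely many strict inequalities hold with a common margin. -/
theorem exists_margin_of_finite {X Y : Type*} [Finite Y] {D : ℕ}
    {Ψ : X → Y → EuclideanSpace ℝ (Fin D)} {w : EuclideanSpace ℝ (Fin D)} {x : X} {l : Y}
    (hw : ∀ y, y ≠ l → inner ℝ w (Ψ x y) < inner ℝ w (Ψ x l)) :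
    ∃ γ : ℝ, 0 < γ ∧ ∀ y, y ≠ l → inner ℝ w (Ψ x y) + γ ≤ inner ℝ w (Ψ x l) := by
  have hev : ∀ y, ∀ᶠ γ in nhdsWithin (0 : ℝ) (Set.Ioi 0), y ≠ l →
      inner ℝ w (Ψ x y) + γ ≤ inner ℝ w (Ψ x l) := fun y => by
    by_cases hy : y = l
    · simp [hy]
    · filter_upwards [Ioo_mem_nhdsGT (sub_pos.2 (hw y hy))] with γ hγ _
      linarith [hγ.2]
  obtain ⟨γ, hγ, hγ0⟩ := ((Filter.eventually_all.2 hev).and self_mem_nhdsWithin).exists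
  exact ⟨γ, hγ0, hγ⟩

/-- Up to a null set, the constraint sets `marginSet Ψ h x` are intersections of closed sets from a
fixed countable family that are selected measurably. -/
theorem MeasurableDifferences.exists_countable_family {X Y : Type*} [MeasurableSpace X] {D : ℕ}
    {Ψ : X → Y → EuclideanSpace ℝ (Fin D)} {P : Measure X} {h : X → Y}
    (hM : MeasurableDifferences Ψ P h) {Z : Set X} (hZ : P Z = 0) :
    ∃ (ι : Type) (A : ι → Set X) (K : ι → Set (EuclideanSpace ℝ (Fin D))) (N : Set X),
      Countable ι ∧ (∀ n, MeasurableSet (A n)) ∧ (∀ n, IsClosed (K n)) ∧ P N = 0 ∧ Z ⊆ N ∧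
      (∀ x, Convex ℝ {w | ∀ n, x ∈ A n → w ∈ K n}) ∧
      ∀ x, x ∉ N → {w | ∀ n, x ∈ A n → w ∈ K n} = marginSet Ψ h x := by
  let ι := TopologicalSpace.countableBasis (EuclideanSpace ℝ (Fin D))
  have hcount : Countable ι := (TopologicalSpace.countable_countableBasis _).to_subtype
  let F : ι → Set X := fun U => {x | ∃ y, y ≠ h x ∧ Ψ x (h x) - Ψ x y ∈ (U : Set _)}
  have hF : ∀ U : ι, NullMeasurableSet (F U) P := fun U =>
    hM U ((TopologicalSpace.isBasis_countableBasis _).isOpen U.2)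
  choose B _ hB hBF using fun U => (hF U).exists_measurable_superset_ae_eq
  let N := toMeasurable P (Z ∪ ⋃ U, {x | ¬ (x ∈ B U ↔ x ∈ F U)})
  have hN0 : P N = 0 := by
    rw [measure_toMeasurable]
    refine measure_union_null hZ (measure_iUnion_null fun U => ?_)
    have : ∀ᵐ x ∂P, x ∈ B U ↔ x ∈ F U := by
      filter_upwards [hBF U] with x hx using iff_of_eq hx
    exact this
  have hNB : ∀ x, x ∉ N → ∀ U, x ∈ B U ↔ x ∈ F U := fun x hx U => by
    by_contra hcon
    exact hx (subset_toMeasurable _ _ (Or.inr (Set.mem_iUnion.2 ⟨U, hcon⟩)))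
  -- `K U` is the constraint left when only a difference somewhere in `U` is known. A violated
  -- constraint stays violated near `(w, z)`, so small basic `U` detect it.
  let K : ι → Set (EuclideanSpace ℝ (Fin D)) := fun U =>
    closure {w | ∃ z ∈ (U : Set (EuclideanSpace ℝ (Fin D))), 1 ≤ inner ℝ w z}
  have key : ∀ x, x ∉ N → {w | ∀ U, x ∈ B U \ N → w ∈ K U} = marginSet Ψ h x := by
    intro x hx
    ext w
    constructor
    · intro hw y hy
      by_contra! hlt
      let z := Ψ x (h x) - Ψ x y
      have hopen : IsOpen {p : EuclideanSpace ℝ (Fin D) × EuclideanSpace ℝ (Fin D) |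
          inner ℝ p.1 p.2 < 1} :=
        isOpen_lt (continuous_fst.inner continuous_snd) continuous_const
      obtain ⟨V, hV, U₀, hU₀, hsub⟩ := mem_nhds_prod_iff.1 (hopen.mem_nhds (x := (w, z)) hlt)
      obtain ⟨U, hU, hzU, hUU₀⟩ :=
        (TopologicalSpace.isBasis_countableBasis (EuclideanSpace ℝ (Fin D))).mem_nhds_iff.1 hU₀
      have hwK := hw ⟨U, hU⟩ ⟨(hNB x hx _).2 ⟨y, hy, hzU⟩, hx⟩
      obtain ⟨w', hw'V, z', hz', hle⟩ := mem_closure_iff_nhds.1 hwK V hV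
      have : inner ℝ w' z' < 1 := hsub (Set.mk_mem_prod hw'V (hUU₀ hz'))
      linarith
    · intro hw U hU
      obtain ⟨y, hy, hyU⟩ := (hNB x hx U).1 hU.1
      exact subset_closure ⟨_, hyU, hw y hy⟩
  refine ⟨ι, fun U => B U \ N, K, N, hcount, fun U => (hB U).diff (measurableSet_toMeasurable _ _),
    fun U => isClosed_closure, hN0, Set.subset_union_left.trans (subset_toMeasurable _ _),
    fun x => ?_, key⟩
  -- Removing `N` from every `B U` leaves no constraint on `N`, so convexity holds everywhere and
  -- not just almost everywhere.
  by_cases hx : x ∈ N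
  · have : {w | ∀ U, x ∈ B U \ N → w ∈ K U} = Set.univ := by
      ext w
      simp [hx]
    rw [this]
    exact convex_univ
  · rw [key x hx]
    exact convex_marginSet Ψ h x

/-- Where `w` satisfies the margin constraints, the correct label is the only optimal one. -/
theorem argmaxLabels_eq_of_mem_marginSet {X Y : Type*} {D : ℕ}
    {Ψ : X → Y → EuclideanSpace ℝ (Fin D)} {h : X → Y} {x : X} {w : EuclideanSpace ℝ (Fin D)}
    (hw : w ∈ marginSet Ψ h x) : argmaxLabels Ψ w x = {h x} := by
  have hlt : ∀ y, y ≠ h x → inner ℝ w (Ψ x y) < inner ℝ w (Ψ x (h x)) := fun y hy => by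
    have := hw y hy
    rw [inner_sub_right] at this
    linarith
  ext y
  constructor
  · intro hy
    by_contra hne
    exact absurd (hy (h x)) (not_le.2 (hlt y hne))
  · rintro rfl y'
    by_cases hy : y' = h x
    · rw [hy]
    · exact (hlt y' hy).le

/-- Puts finite and infinite label sets on the same footing: feasibility of the program only needs a
positive margin at each sample point. -/
theorem NoTies.exists_ae_margin {X Y : Type*} [MeasurableSpace X] {D : ℕ}
    {Ψ : X → Y → EuclideanSpace ℝ (Fin D)} {P : Measure X} {h : X → Y} (hT : NoTies Ψ P h) :
    ∃ w : EuclideanSpace ℝ (Fin D), ∀ᵐ x ∂P, ∃ γ : ℝ, 0 < γ ∧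
      ∀ y, y ≠ h x → inner ℝ w (Ψ x y) + γ ≤ inner ℝ w (Ψ x (h x)) := by
  obtain ⟨w, -, hw, hinf⟩ := hT
  refine ⟨w, ?_⟩
  rcases finite_or_infinite Y with hY | hY
  · filter_upwards [hw] with x hx
    refine exists_margin_of_finite fun y hy => ?_
    by_contra! hle
    have hmem : h x ∈ argmaxLabels Ψ w x := hx ▸ rfl
    have : y ∈ argmaxLabels Ψ w x := fun y' => (hmem y').trans hle
    rw [hx] at this
    exact hy this
  · exact hinf hY

/-! ### The compression bound. -/

/-- The compression bound: the SVM solution is determined by `D` of the `k` examples, hence its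
error exceeds `ε` with probability at most `k.choose D * (1 - ε) ^ (k - D)`. -/
theorem IsSVMLearner.measure_error_le {X Y : Type*} [MeasurableSpace X] {D : ℕ}
    {Ψ : X → Y → EuclideanSpace ℝ (Fin D)} {A : Learner X Y} (hA : IsSVMLearner Ψ A)
    {P : Measure X} [IsProbabilityMeasure P] {h : X → Y} (hT : NoTies Ψ P h)
    (hM : MeasurableDifferences Ψ P h) {k : ℕ} (hDk : D ≤ k) (ε : ℝ≥0∞) :
    Measure.pi (fun _ : Fin k => P)
      {x | ε < predictionError P h (A k fun i => (x i, h (x i)))}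
        ≤ k.choose D * (1 - ε) ^ (k - D) := by
  obtain ⟨w₀, hw₀⟩ := hT.exists_ae_margin
  obtain ⟨ι, B, K, N, hι, hB, hK, hN, hZN, hcv, heq⟩ :=
    hM.exists_countable_family (Z := {x | ¬ ∃ γ : ℝ, 0 < γ ∧
      ∀ y, y ≠ h x → inner ℝ w₀ (Ψ x y) + γ ≤ inner ℝ w₀ (Ψ x (h x))}) hw₀
  have hsel : ∀ T : Finset (Fin k), ∃ W : ({i // i ∈ T} → X) → EuclideanSpace ℝ (Fin D),
      Measurable W ∧ ∀ s v, IsMinNormPoint (⋂ i, {w | ∀ n, s i ∈ B n → w ∈ K n}) v → W s = v := by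
    intro T
    have hset : ∀ s : {i // i ∈ T} → X, (⋂ i, {w | ∀ n, s i ∈ B n → w ∈ K n}) =
        {w | ∀ p : ι × {i // i ∈ T}, s ∈ Function.eval p.2 ⁻¹' B p.1 → w ∈ K p.1} := by
      intro s
      ext w
      simp only [Set.mem_iInter, Set.mem_ofPred_eq, Prod.forall, Set.mem_preimage,
        Function.eval]
      exact forall_comm
    simp only [hset]
    refine exists_measurable_isMinNormPoint (A := fun p : ι × {i // i ∈ T} =>
        (Function.eval p.2 ⁻¹' B p.1 : Set ({i // i ∈ T} → X))) (K := fun p => K p.1)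
      (fun p => (measurable_pi_apply p.2) (hB p.1)) (fun p => hK p.1) fun s => ?_
    rw [← hset]
    exact convex_iInter fun i => hcv (s i)
  choose W hW hWmin using hsel
  -- Failure means a violated margin, not a wrong label: this depends on the vector alone, is
  -- measurable, and contains all errors up to `N`, however `A` breaks ties.
  let M : (T : Finset (Fin k)) → Set (({i // i ∈ T} → X) × X) :=
    fun T => {p | ∃ n, p.2 ∈ B n ∧ W T p.1 ∉ K n}
  have hMm : ∀ T, MeasurableSet (M T) := fun T => by
    have : M T = ⋃ n, (Prod.snd ⁻¹' B n ∩ (fun p => W T p.1) ⁻¹' (K n)ᶜ) := by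
      ext p
      simp [M]
    rw [this]
    exact MeasurableSet.iUnion fun n => (measurable_snd (hB n)).inter
      (((hW T).comp measurable_fst) (hK n).measurableSet.compl)
  let E : Finset (Fin k) → Set (Fin k → X) := fun T =>
    {x | ε < P {z | ((fun i : {i // i ∈ T} => x i), z) ∈ M T} ∧
      ∀ j, j ∉ T → ((fun i : {i // i ∈ T} => x i), x j) ∉ M T}
  -- The bad event need not be measurable; covering it suffices, as `Measure.pi` is monotone on all
  -- sets.
  have hsub : {x | ε < predictionError P h (A k fun i => (x i, h (x i)))} ⊆
      (⋃ i : Fin k, Function.eval i ⁻¹' N) ∪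
        ⋃ T ∈ Finset.powersetCard D (Finset.univ : Finset (Fin k)), E T := by
    intro x hx
    by_cases hxN : ∃ i, x i ∈ N
    · exact Or.inl (Set.mem_iUnion.2 hxN)
    push Not at hxN
    right
    have hne : (svmFeasible Ψ fun i => (x i, h (x i))).Nonempty :=
      svmFeasible_nonempty (w := w₀) fun i => by
        by_contra hcon
        exact hxN i (hZN hcon)
    obtain ⟨w, hw, -⟩ := existsUnique_isMinNormPoint hne (isClosed_svmFeasible Ψ _)
      (convex_svmFeasible Ψ _)
    have hw' := hw
    rw [svmFeasible_eq_iInter_marginSet] at hw'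
    obtain ⟨T, hcard, hTw⟩ := hw'.exists_card_eq hDk fun i => convex_marginSet Ψ h (x i)
    have hWw : W T (fun i => x i) = w := by
      refine hWmin T _ w ?_
      have : (⋂ i : {i // i ∈ T}, {w | ∀ n, x i ∈ B n → w ∈ K n}) =
          ⋂ i : {i // i ∈ T}, marginSet Ψ h (x i) := Set.iInter_congr fun i => heq _ (hxN i)
      rw [this]
      exact hTw
    have hmemM : ∀ z, z ∉ N → (((fun i : {i // i ∈ T} => x i), z) ∈ M T ↔ w ∉ marginSet Ψ h z) := by
      intro z hz
      rw [← heq z hz]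
      simp [M, hWw]
    refine Set.mem_iUnion₂.2 ⟨T, by simp [Finset.mem_powersetCard, hcard], ?_, ?_⟩
    · refine lt_of_lt_of_le hx ?_
      have hincl : {z | h z ≠ A k (fun i => (x i, h (x i))) z} ⊆
          {z | ((fun i : {i // i ∈ T} => x i), z) ∈ M T} ∪ N := by
        intro z hz
        by_cases hzN : z ∈ N
        · exact Or.inr hzN
        refine Or.inl ((hmemM z hzN).2 fun hwz => hz ?_)
        have hs := argmaxLabels_eq_of_mem_marginSet hwz
        have := hA k _ w hw z (hs ▸ Set.singleton_nonempty _)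
        rw [hs] at this
        exact this.symm
      refine (measure_mono hincl).trans ((measure_union_le _ _).trans ?_)
      rw [hN, add_zero]
    · intro j _
      rw [hmemM _ (hxN j), not_not]
      exact Set.mem_iInter.1 hw'.1 j
  calc _ ≤ _ := measure_mono hsub
    _ ≤ Measure.pi (fun _ : Fin k => P) (⋃ i : Fin k, Function.eval i ⁻¹' N) +
          ∑ T ∈ Finset.powersetCard D (Finset.univ : Finset (Fin k)),
            Measure.pi (fun _ : Fin k => P) (E T) :=
        (measure_union_le _ _).trans (add_le_add_right (measure_biUnion_finset_le _ _) _)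
    _ = ∑ T ∈ Finset.powersetCard D (Finset.univ : Finset (Fin k)),
            Measure.pi (fun _ : Fin k => P) (E T) := by
        rw [measure_iUnion_null fun i => Measure.pi_eval_preimage_null _ hN, zero_add]
    _ ≤ ∑ _T ∈ Finset.powersetCard D (Finset.univ : Finset (Fin k)), (1 - ε) ^ (k - D) := by
        refine Finset.sum_le_sum fun T hT => ?_
        rw [← (Finset.mem_powersetCard.1 hT).2]
        exact measure_pi_consistent_le P T ε (hMm T)
    _ = k.choose D * (1 - ε) ^ (k - D) := by
        rw [Finset.sum_const, Finset.card_powersetCard, Finset.card_univ, Fintype.card_fin,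
          nsmul_eq_mul]

/-! ### From the tail bound to the sample size. -/

theorem log_two_le_log_one_div {ε : ℝ} (h0 : 0 < ε) (h1 : ε ≤ 1 / 2) : Real.log 2 ≤ Real.log (1 / ε) := by
  refine Real.log_le_log (by norm_num) ?_
  rw [le_div_iff₀ h0]
  linarith

/-- Splitting `k ^ D / D!` as `(4 / ε) ^ D * ((ε * k / 4) ^ D / D!)` bounds the binomial by `(4 / ε)
^ D * exp (ε * k / 4)`, which avoids a `log k`. With `L = log (1 / ε)`, `log 4 ≤ 2 * L` and `ε ≤ L`,
the exponent is at most `4 * D * L - (3 / 4) * ε * k`, and the constant `6` makes this at most `log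
δ`. -/
theorem choose_mul_one_sub_pow_le {D k : ℕ} {ε δ : ℝ} (hDk : D ≤ k) (h0 : 0 < ε) (h1 : ε ≤ 1 / 2)
    (hδ : 0 < δ) (hδ1 : δ < 1)
    (hk : 6 * ((D * Real.log (1 / ε) + Real.log (1 / δ)) / ε) ≤ k) :
    (k.choose D : ℝ) * (1 - ε) ^ (k - D) ≤ δ := by
  have hL := log_two_le_log_one_div h0 h1
  have hl2 := Real.log_two_gt_d9
  set L := Real.log (1 / ε) with hLdef
  have hlδ : 0 ≤ Real.log (1 / δ) := Real.log_nonneg (by rw [le_div_iff₀ hδ]; linarith)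
  have hlδ' : Real.log (1 / δ) = - Real.log δ := by rw [one_div, Real.log_inv]
  have hLε : L = - Real.log ε := by rw [hLdef, one_div, Real.log_inv]
  have hD0 : (0 : ℝ) ≤ D := Nat.cast_nonneg D
  have hmain : 6 * (D * L + Real.log (1 / δ)) ≤ ε * k := by
    have := mul_le_mul_of_nonneg_left hk h0.le
    rwa [← mul_assoc, mul_comm ε 6, mul_assoc, mul_div_cancel₀ _ h0.ne'] at this
  have hchoose : (k.choose D : ℝ) ≤ (4 / ε) ^ D * Real.exp (ε * k / 4) := by
    calc (k.choose D : ℝ) ≤ (k : ℝ) ^ D / D.factorial := Nat.choose_le_pow_div D k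
      _ = (4 / ε) ^ D * ((ε * k / 4) ^ D / D.factorial) := by
        rw [← mul_div_assoc, ← mul_pow]
        congr 2
        field_simp
      _ ≤ (4 / ε) ^ D * Real.exp (ε * k / 4) :=
        mul_le_mul_of_nonneg_left (Real.pow_div_factorial_le_exp _ (by positivity) D) (by positivity)
  have hpow : (1 - ε) ^ (k - D) ≤ Real.exp (-ε * (k - D)) := by
    calc (1 - ε) ^ (k - D) ≤ Real.exp (-ε) ^ (k - D) :=
          pow_le_pow_left₀ (by linarith) (Real.one_sub_le_exp_neg ε) _
      _ = Real.exp (-ε * (k - D)) := by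
        rw [← Real.exp_nat_mul, Nat.cast_sub hDk, mul_comm]
  have h4 : (4 / ε) ^ D = Real.exp (D * (Real.log 4 + L)) := by
    rw [hLε, ← sub_eq_add_neg, ← Real.log_div (by norm_num) h0.ne', ← Real.log_pow,
      Real.exp_log (by positivity)]
  have hlog4 : Real.log 4 = 2 * Real.log 2 := by
    rw [show (4 : ℝ) = 2 ^ 2 by norm_num, Real.log_pow]
    norm_num
  have hD4 : (D : ℝ) * Real.log 4 ≤ D * (2 * L) := mul_le_mul_of_nonneg_left (by linarith) hD0
  have hDε : (D : ℝ) * ε ≤ D * L := mul_le_mul_of_nonneg_left (by linarith) hD0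
  calc (k.choose D : ℝ) * (1 - ε) ^ (k - D)
      ≤ ((4 / ε) ^ D * Real.exp (ε * k / 4)) * Real.exp (-ε * (k - D)) :=
        mul_le_mul hchoose hpow (pow_nonneg (by linarith) _) (by positivity)
    _ = Real.exp (D * (Real.log 4 + L) + ε * k / 4 + -ε * (k - D)) := by
        rw [h4, ← Real.exp_add, ← Real.exp_add]
    _ ≤ Real.exp (Real.log δ) := by
        refine Real.exp_le_exp.2 ?_
        nlinarith
    _ = δ := Real.exp_log hδ

theorem SufficientSampleSize.mono_error {X Y : Type*} [MeasurableSpace X] {D : ℕ}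
    {Ψ : X → Y → EuclideanSpace ℝ (Fin D)} {H : Set (X → Y)} {A : Learner X Y} {ε ε' δ : ℝ} {n : ℕ}
    (hn : SufficientSampleSize Ψ H A ε δ n) (hε : ε ≤ ε') : SufficientSampleSize Ψ H A ε' δ n :=
  fun k hk P hP h hH hT hM => (measure_mono fun _ hx =>
    (ENNReal.ofReal_le_ofReal hε).trans_lt hx).trans (hn k hk P hP h hH hT hM)

/-- In dimension `0` there is only one label, unless there are ties. -/
theorem sufficientSampleSize_zero {X Y : Type*} [MeasurableSpace X]
    (Ψ : X → Y → EuclideanSpace ℝ (Fin 0)) (H : Set (X → Y)) (A : Learner X Y) (ε δ : ℝ) :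
    SufficientSampleSize Ψ H A ε δ 0 := by
  intro k _ P hP h _ hT _
  obtain ⟨w, -, hw, -⟩ := hT
  obtain ⟨x₀, hx₀⟩ := hw.exists
  have huniv : ∀ y, y = h x₀ := fun y => by
    have hy : y ∈ argmaxLabels Ψ w x₀ := fun y' =>
      (congrArg (inner ℝ w) (Subsingleton.elim (Ψ x₀ y') (Ψ x₀ y))).le
    rw [hx₀] at hy
    exact hy
  have hzero : ∀ g : X → Y, predictionError P h g = 0 := fun g => by
    have : {x | h x ≠ g x} = ∅ := by
      ext x
      simp [huniv (h x), huniv (g x)]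
    rw [predictionError, this, measure_empty]
  simp [hzero]

/-- The sample size needed by the SVM. -/
theorem IsSVMLearner.exists_sufficientSampleSize {X Y : Type*} [MeasurableSpace X] {D : ℕ}
    {Ψ : X → Y → EuclideanSpace ℝ (Fin D)} {A : Learner X Y} (hA : IsSVMLearner Ψ A)
    (H : Set (X → Y)) {ε δ : ℝ} (h0 : 0 < ε) (h1 : ε ≤ 1 / 2) (hδ : 0 < δ) (hδ1 : δ < 1) :
    ∃ n : ℕ, SufficientSampleSize Ψ H A ε δ n ∧
      (n : ℝ) ≤ 7 * ((D * Real.log (1 / ε) + Real.log (1 / δ)) / ε) := by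
  have hL := log_two_le_log_one_div h0 h1
  have hl2 := Real.log_two_gt_d9
  have hlδ : 0 ≤ Real.log (1 / δ) := Real.log_nonneg (by rw [le_div_iff₀ hδ]; linarith)
  -- For `D = 0` the bound may be below `1`, so rounding up is not allowed. For `D ≥ 1` it follows
  -- that `R ≥ 1`, and rounding `6 * R` up costs at most one more `R`.
  rcases Nat.eq_zero_or_pos D with rfl | hD
  · refine ⟨0, sufficientSampleSize_zero Ψ H A ε δ, ?_⟩
    have : 0 ≤ Real.log (1 / δ) / ε := div_nonneg hlδ h0.le
    simpa using this
  have hD1 : (1 : ℝ) ≤ D := by exact_mod_cast hD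
  set R := (D * Real.log (1 / ε) + Real.log (1 / δ)) / ε with hR
  have hRD : (D : ℝ) ≤ R := by
    rw [hR, le_div_iff₀ h0]
    nlinarith
  refine ⟨⌈6 * R⌉₊, fun k hk P hP h _ hT hM => ?_, ?_⟩
  · have hkR : 6 * R ≤ k := (Nat.le_ceil _).trans (by exact_mod_cast hk)
    have hDk : D ≤ k := by
      have : (D : ℝ) ≤ k := by linarith
      exact_mod_cast this
    refine (hA.measure_error_le hT hM hDk _).trans ?_
    rw [← ENNReal.ofReal_one, ← ENNReal.ofReal_sub _ h0.le, ← ENNReal.ofReal_pow (by linarith),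
      ← ENNReal.ofReal_natCast, ← ENNReal.ofReal_mul (Nat.cast_nonneg _)]
    exact ENNReal.ofReal_le_ofReal (choose_mul_one_sub_pow_le hDk h0 h1 hδ hδ1 hkR)
  · have := Nat.ceil_lt_add_one (a := 6 * R) (by linarith)
    linarith

/-! ### The convex hull of the differences. -/

/-- The SVM solution is a positive multiple of the point of smallest norm of the convex hull of the
differences. -/
theorem IsSVMSolution.eq_smul {X Y : Type*} {D m : ℕ} {Ψ : X → Y → EuclideanSpace ℝ (Fin D)}
    {S : Fin m → X × Y} {w w' : EuclideanSpace ℝ (Fin D)} (hw : IsSVMSolution Ψ S w)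
    (hw' : IsMinNormPoint (convexHull ℝ (sampleDifferences Ψ S)) w') :
    0 < ‖w‖ / ‖w'‖ ∧ w = (‖w‖ / ‖w'‖) • w' := by
  have hww' : 1 ≤ inner ℝ w w' := by
    have hcvx : Convex ℝ {z : EuclideanSpace ℝ (Fin D) | 1 ≤ inner ℝ w z} :=
      convex_halfSpace_ge (innerSL ℝ w).isLinear 1
    refine convexHull_min ?_ hcvx hw'.1
    rintro _ ⟨i, y, hy, rfl⟩
    exact hw.1 i y hy
  have hpos : 0 < ‖w‖ * ‖w'‖ := lt_of_lt_of_le one_pos (hww'.trans (real_inner_le_norm w w'))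
  have hw'0 : 0 < ‖w'‖ := pos_of_mul_pos_right hpos (norm_nonneg w)
  have hw0 : 0 < ‖w‖ := pos_of_mul_pos_left hpos (norm_nonneg w')
  -- The variational inequality `‖w'‖ ^ 2 ≤ ⟪w', z⟫` on the hull is the margin constraint after
  -- rescaling.
  have hfeas : (‖w'‖ ^ 2)⁻¹ • w' ∈ svmFeasible Ψ S := fun i y hy => by
    have := hw'.sq_norm_le_inner (convex_convexHull ℝ _) (subset_convexHull ℝ _ ⟨i, y, hy, rfl⟩)
    rw [real_inner_smul_left, inv_mul_eq_div, le_div_iff₀ (by positivity), one_mul]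
    exact this
  have hle : ‖w‖ * ‖w'‖ ≤ 1 := by
    have := hw.2 _ hfeas
    rw [norm_smul, norm_inv, norm_pow, norm_norm, inv_mul_eq_div, le_div_iff₀ (by positivity)] at this
    nlinarith
  refine ⟨div_pos hw0 hw'0, ?_⟩
  have hinner : inner ℝ w w' = ‖w‖ * ‖w'‖ :=
    le_antisymm (real_inner_le_norm w w') (hle.trans hww')
  rw [inner_eq_norm_mul_iff_real] at hinner
  rw [div_eq_inv_mul, mul_smul, ← hinner, smul_smul, inv_mul_cancel₀ hw'0.ne', one_smul]

theorem existsUnique_isSVMSolution {X Y : Type*} [Finite Y] {D m : ℕ}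
    {Ψ : X → Y → EuclideanSpace ℝ (Fin D)} {S : Fin m → X × Y} (hS : IsRealized Ψ S) :
    ∃! w, IsSVMSolution Ψ S w := by
  obtain ⟨v, hv⟩ := hS
  exact existsUnique_isMinNormPoint (svmFeasible_nonempty fun i => exists_margin_of_finite (hv i))
    (isClosed_svmFeasible Ψ S) (convex_svmFeasible Ψ S)

theorem finite_sampleDifferences {X Y : Type*} [Finite Y] {D m : ℕ}
    (Ψ : X → Y → EuclideanSpace ℝ (Fin D)) (S : Fin m → X × Y) : (sampleDifferences Ψ S).Finite := by
  refine (Set.finite_range fun p : Fin m × Y => Ψ (S p.1).1 (S p.1).2 - Ψ (S p.1).1 p.2).subset ?_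
  rintro _ ⟨i, y, -, rfl⟩
  exact ⟨(i, y), rfl⟩

theorem theoremt :
    -- the sample complexity of the SVM, with an absolute constant
    (∃ C : ℝ, 0 < C ∧
      ∀ (X : Type*) (Y : Type*) [MeasurableSpace X] (D : ℕ)
        (Ψ : X → Y → EuclideanSpace ℝ (Fin D)) (H : Set (X → Y)) (A : Learner X Y),
        IsLinearClass Ψ H → IsSVMLearner Ψ A →
        ∀ ε δ : ℝ, 0 < ε → ε < 1 → 0 < δ → δ < 1 →
          ∃ n : ℕ, IsSampleComplexity Ψ H A ε δ n ∧
            (ε ≤ 1 / 2 →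
              (n : ℝ) ≤ C * ((D * Real.log (1 / ε) + Real.log (1 / δ)) / ε))) ∧
    -- the SVM solution is a positive multiple of the minimum-norm point of `conv Z`
    (∀ (X : Type*) (Y : Type*) (D m : ℕ) (Ψ : X → Y → EuclideanSpace ℝ (Fin D))
        (S : Fin m → X × Y),
      (∀ w w' : EuclideanSpace ℝ (Fin D), IsSVMSolution Ψ S w →
        IsMinNormPoint (convexHull ℝ (sampleDifferences Ψ S)) w' →
        0 < ‖w‖ / ‖w'‖ ∧ w = (‖w‖ / ‖w'‖) • w') ∧
      (Finite Y → IsRealized Ψ S →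
        (∃! w, IsSVMSolution Ψ S w) ∧
        ((sampleDifferences Ψ S).Nonempty →
          ∃! w', IsMinNormPoint (convexHull ℝ (sampleDifferences Ψ S)) w'))) := by
  refine ⟨⟨7, by norm_num, ?_⟩, ?_⟩
  · intro X Y _ D Ψ H A _ hA ε δ h0 h1 hδ hδ1
    -- Accuracy `min ε (1 / 2)` also settles finiteness for `ε > 1 / 2`.
    obtain ⟨n, hn, hle⟩ := hA.exists_sufficientSampleSize H (lt_min h0 one_half_pos)
      (min_le_right ε (1 / 2)) hδ hδ1
    have hn' : SufficientSampleSize Ψ H A ε δ n := hn.mono_error (min_le_left _ _)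
    classical
    have hex : ∃ n, SufficientSampleSize Ψ H A ε δ n := ⟨n, hn'⟩
    refine ⟨Nat.find hex, ⟨Nat.find_spec hex, fun j hj => Nat.find_min' hex hj⟩, fun hε => ?_⟩
    rw [min_eq_left hε] at hle
    exact le_trans (by exact_mod_cast Nat.find_min' hex hn') hle
  · intro X Y D m Ψ S
    refine ⟨fun w w' hw hw' => hw.eq_smul hw', fun _ hS => ⟨existsUnique_isSVMSolution hS,
      fun hne => existsUnique_isMinNormPoint hne.convexHull ?_ (convex_convexHull ℝ _)⟩⟩
    exact (finite_sampleDifferences Ψ S).isClosed_convexHull ℝ
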